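/- Let $A$ be a reduced excellent ring (commutative with one; excellent means Noetherian, universally catenary, with geometrically regular formal fibres at all primes, and such that every finitely generated $A$-algebra has an open regular locus). Let $Q(A)$ be its total ring of fractions and let $$\mathrm{Sing}(A)=\{P\in\mathrm{Spec}(A)\mid A_P\text{ is not a regular local ring}\}.$$ For an ideal $J\subseteq A$ define rings $A\subseteq A_i\subseteq Q(A)$ by $A_0=A$ and $$A_{i+1}=\mathrm{End}_{A_i}\big(\sqrt{JA_i}\big),$$ where, for a ring $A\subseteq B\subseteq Q(A)$ and an ideal $I$ of $B$, $\mathrm{End}_B(I)$ is identified with the subring of all $x\in Q(A)$ such that multiplication by $x$ is a $B$-linear endomorphism of $I$ (if $I$ contains a non-zerodivisor $g$, then $\varphi\in\mathrm{End}_B(I)$ corresponds to $\varphi(g)/g$). Let $n(A,J)\in\mathbb N\cup\{\infty\}$ be the least $n$ with $A_n=A_{n+1}$ ($\infty$ if there is none). For $P\in\mathrm{Sing}(A)$ let $L_P$ be the intersection of all $\widetilde P\in\mathrm{Sing}(A)$ with $\widetilde P\subseteq P$. The strata of $\mathrm{Sing}(A)$ are the non-empty sets $W_L=\{P\in\mathrm{Sing}(A)\mid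 L_P=L\}$; write $\mathrm{Strata}(A)$ for the set of all strata, and $L_W$ for the constant value of $P\mapsto L_P$ on a stratum $W$. Let $J=\bigcap_{P\in\mathrm{Sing}(A)}P$ be the vanishing ideal of $\mathrm{Sing}(A)$. Then $\mathrm{Strata}(A)$ is finite, and $$n(A,J)\le\max_{W\in\mathrm{Strata}(A)}n(A,L_W),$$ where the maximum over the empty set is $0$. If, moreover, $A$ is equidimensional (that is, $\dim A/\mathfrak p=\dim A$ for all minimal primes $\mathfrak p$ of $A$) and satisfies Serre's condition $(S_2)$ (that is, $\mathrm{depth}\,A_P\ge\min\{2,\dim A_P\}$ for all $P\in\mathrm{Spec}(A)$), then equality holds. -/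

import Mathlib

open scoped TensorProduct

universe u

namespace StratNorm

noncomputable section

/-! ### Singular locus, depth, Serre's condition, equidimensionality -/

/-- The singular locus: all primes `P` such that `A_P` is not a regular local ring. -/
def Sing (A : Type u) [CommRing A] : Set (PrimeSpectrum A) :=
  {P | ¬ IsRegularLocalRing (Localization.AtPrime P.asIdeal)}

/-- The depth of a local ring: the supremum of the lengths of the regular sequences in its
maximal ideal. -/
def depth (R : Type u) [CommRing R] [IsLocalRing R] : ℕ∞ :=
  ⨆ (rs : List R) (_ : (∀ r ∈ rs, r ∈ IsLocalRing.maximalIdeal R) ∧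
    RingTheory.Sequence.IsRegular R rs), (rs.length : ℕ∞)

/-- Serre's condition `(S_i)`: `depth R_P ≥ min {i, dim R_P}` for all primes `P`. -/
def SerreS (i : ℕ) (R : Type u) [CommRing R] : Prop :=
  ∀ P : PrimeSpectrum R,
    min ((i : ℕ∞) : WithBot ℕ∞) (ringKrullDim (Localization.AtPrime P.asIdeal)) ≤
      (depth (Localization.AtPrime P.asIdeal) : WithBot ℕ∞)

/-- All irreducible components of the spectrum have the same dimension. -/
def IsEquidimensional (R : Type u) [CommRing R] : Prop :=
  ∀ p ∈ minimalPrimes R, ringKrullDim (R ⧸ p) = ringKrullDim R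

/-! ### Excellent rings -/

/-- Any two saturated chains of primes with the same end points have the same length. -/
def IsCatenary (R : Type u) [CommRing R] : Prop :=
  ∀ s t : RelSeries {(P, Q) : PrimeSpectrum R × PrimeSpectrum R | P ⋖ Q},
    s.head = t.head → s.last = t.last → s.length = t.length

/-- For a local ring `R`: the formal fibres `κ(q) ⊗ R̂` are geometrically regular over `κ(q)`,
that is, they stay regular under every finite extension of `κ(q)`. -/
def HasGeomRegularFormalFibres (R : Type u) [CommRing R] [IsLocalRing R] : Prop :=
  ∀ (q : Ideal R) [q.IsPrime] (L : Type u) [Field L] [Algebra q.ResidueField L]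
    [Module.Finite q.ResidueField L],
    IsRegularRing
      (L ⊗[q.ResidueField] (q.ResidueField ⊗[R] AdicCompletion (IsLocalRing.maximalIdeal R) R))

/-- Excellent rings: Noetherian, universally catenary, with geometrically regular formal fibres
at all primes (G-ring), and such that every finitely generated algebra has an open regular locus
(J-2). -/
structure IsExcellentRing (A : Type u) [CommRing A] : Prop where
  isNoetherianRing : IsNoetherianRing A
  catenary : ∀ (B : Type u) [CommRing B] [Algebra A B] [Algebra.FiniteType A B], IsCatenary B
  formalFibres : ∀ P : PrimeSpectrum A,
    HasGeomRegularFormalFibres (Localization.AtPrime P.asIdeal)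
  isOpen_regularLocus : ∀ (B : Type u) [CommRing B] [Algebra A B] [Algebra.FiniteType A B],
    IsOpen (Sing B)ᶜ

/-! ### The normalization algorithm -/

/-- For a ring `A ⊆ B ⊆ Q(A)` and an ideal `I` of `B`, the ring `End_B(I)` seen inside the total
ring of fractions `Q(A)`: all `x` such that multiplication by `x` is a `B`-endomorphism of `I`.
(If `I` contains a non-zerodivisor `g`, every `φ ∈ End_B(I)` is multiplication by the unique
element `φ(g)/g`.) -/
def endRing {A : Type u} [CommRing A] (B : Subalgebra A (FractionRing A)) (I : Ideal B) :
    Subalgebra A (FractionRing A) where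
  carrier := {x | ∃ φ : Module.End B I, ∀ j : I,
    (((φ j : I) : B) : FractionRing A) = x * ((j : B) : FractionRing A)}
  mul_mem' := by
    rintro x y ⟨φ, hφ⟩ ⟨ψ, hψ⟩
    exact ⟨φ * ψ, fun j => by rw [Module.End.mul_apply, hφ, hψ, mul_assoc]⟩
  add_mem' := by
    rintro x y ⟨φ, hφ⟩ ⟨ψ, hψ⟩
    refine ⟨φ + ψ, fun j => ?_⟩
    rw [add_mul, ← hφ, ← hψ]
    simp
  algebraMap_mem' := by
    intro a
    refine ⟨algebraMap B (Module.End B I) (algebraMap A B a), fun j => ?_⟩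
    rw [Module.algebraMap_end_apply]
    rfl

/-- The rings `A_i`: `A_0 = A` and `A_{i+1} = End_{A_i}(J_i)` with `J_i = √(J A_i)`. -/
def chain {A : Type u} [CommRing A] (J : Ideal A) : ℕ → Subalgebra A (FractionRing A)
  | 0 => ⊥
  | i + 1 => endRing (chain J i) (J.map (algebraMap A (chain J i))).radical

/-- The number of steps `n(A, J)`: the least `n` with `A_n = A_{n+1}` (and `⊤` if there is
none). -/
def numSteps (A : Type u) [CommRing A] (J : Ideal A) : ℕ∞ :=
  ⨅ (n : ℕ) (_ : chain J n = chain J (n + 1)), (n : ℕ∞)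

/-! ### The stratification of the singular locus -/

/-- `L_P`: the intersection of all singular primes contained in `P`. -/
def idealAt (A : Type u) [CommRing A] (P : PrimeSpectrum A) : Ideal A :=
  ⨅ (P' : PrimeSpectrum A) (_ : P' ∈ Sing A ∧ P'.asIdeal ≤ P.asIdeal), P'.asIdeal

/-- `W_L`: all singular primes `P` with `L_P = L`. -/
def stratum (A : Type u) [CommRing A] (L : Ideal A) : Set (PrimeSpectrum A) :=
  {P | P ∈ Sing A ∧ idealAt A P = L}

/-- The set of all strata `W_L`, where `L` runs through the values `L_P`, `P ∈ Sing(A)`. -/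
def Strata (A : Type u) [CommRing A] : Set (Set (PrimeSpectrum A)) :=
  stratum A '' (idealAt A '' Sing A)

/-- `L_W`: the constant value of `P ↦ L_P` on a stratum `W` (written as an intersection). -/
def stratumIdeal (A : Type u) [CommRing A] (W : Set (PrimeSpectrum A)) : Ideal A :=
  ⨅ P ∈ W, idealAt A P

theorem stratumIdeal_eq (A : Type u) [CommRing A] {W : Set (PrimeSpectrum A)} (hW : W ∈ Strata A)
    {P : PrimeSpectrum A} (hP : P ∈ W) : stratumIdeal A W = idealAt A P := by
  obtain ⟨L, -, rfl⟩ := hW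
  refine le_antisymm (iInf₂_le P hP) (le_iInf₂ fun P' hP' => ?_)
  rw [hP.2, hP'.2]

end

end StratNorm

/-! Saturation at a prime `P` is the passage to the localization at `P` and back. By exactness of
localization it commutes with radicals and, on finitely generated submodules of `Q(A)`, with the
colon that defines `End`, so the saturation of `A_i` at `P` depends only on the saturation of `J`.
When `J` is the vanishing ideal of `Sing A`, its saturation at `P` is exactly `L_P`, and `A_n` is
determined by its saturations at all primes: this gives the inequality.

Under `(S₂)` the ring `A`, and with it every `A_n`, is determined by its saturations at the primes
of height at most one. At such a prime `Q`, an ideal `L ⊇ J` becomes either the unit ideal or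
agrees with `J`, as `Q` is then minimal over the radical ideal `J`. Hence `A_n` being stable for
`J` forces it to be stable for every `L_P`. -/

namespace StratNorm

section Saturation

variable {A : Type*} [CommRing A] {V : Type*} [AddCommGroup V] [Module A V]
  {S : Submonoid A} {M N : Submodule A V}

/-- The saturation of a submodule with respect to a multiplicative set `S`: the preimage of its
localization under `V → S⁻¹V`. For `S` the complement of a prime `P`, two submodules have the same
saturation if and only if they become equal after localization at `P`. -/
def saturation (S : Submonoid A) (N : Submodule A V) : Submodule A V where
  carrier := {v | ∃ s ∈ S, s • v ∈ N}
  zero_mem' := ⟨1, S.one_mem, by rw [smul_zero]; exact N.zero_mem⟩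
  add_mem' := by
    rintro v w ⟨s, hs, hv⟩ ⟨t, ht, hw⟩
    refine ⟨s * t, S.mul_mem hs ht, ?_⟩
    rw [smul_add, mul_smul, mul_smul, smul_comm s t v]
    exact N.add_mem (N.smul_mem t hv) (N.smul_mem s hw)
  smul_mem' := by
    rintro a v ⟨s, hs, hv⟩
    exact ⟨s, hs, by rw [smul_comm]; exact N.smul_mem a hv⟩

theorem le_saturation : N ≤ saturation S N := fun v hv => ⟨1, S.one_mem, by rwa [one_smul]⟩

theorem saturation_le_saturation_iff : saturation S M ≤ saturation S N ↔ M ≤ saturation S N := by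
  refine ⟨le_saturation.trans, ?_⟩
  rintro h v ⟨s, hs, hv⟩
  obtain ⟨t, ht, hst⟩ := h hv
  exact ⟨t * s, S.mul_mem ht hs, by rwa [mul_smul]⟩

theorem saturation_mono (h : M ≤ N) : saturation S M ≤ saturation S N :=
  saturation_le_saturation_iff.mpr (h.trans le_saturation)

theorem saturation_saturation : saturation S (saturation S N) = saturation S N :=
  le_antisymm (saturation_le_saturation_iff.mpr le_rfl) le_saturation

theorem exists_smul_mem_of_fg_of_le_saturation (hM : M.FG) (h : M ≤ saturation S N) :
    ∃ s ∈ S, ∀ v ∈ M, s • v ∈ N := by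
  induction M, hM using Submodule.fg_induction with
  | singleton x =>
    obtain ⟨s, hs, hx⟩ := h (Submodule.mem_span_singleton_self x)
    refine ⟨s, hs, fun v hv => ?_⟩
    obtain ⟨a, rfl⟩ := Submodule.mem_span_singleton.mp hv
    rw [smul_comm]
    exact N.smul_mem a hx
  | sup M₁ M₂ _ _ ih₁ ih₂ =>
    obtain ⟨s, hs, h₁⟩ := ih₁ (le_sup_left.trans h)
    obtain ⟨t, ht, h₂⟩ := ih₂ (le_sup_right.trans h)
    refine ⟨s * t, S.mul_mem hs ht, fun v hv => ?_⟩
    obtain ⟨y, hy, z, hz, rfl⟩ := Submodule.mem_sup.mp hv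
    rw [smul_add, mul_smul, mul_smul, smul_comm s t y]
    exact N.add_mem (N.smul_mem t (h₁ y hy)) (N.smul_mem s (h₂ z hz))

theorem iInf_saturation_primeCompl (N : Submodule A V) :
    ⨅ P : PrimeSpectrum A, saturation P.asIdeal.primeCompl N = N := by
  refine le_antisymm (fun v hv => ?_) (le_iInf fun _ => le_saturation)
  rw [Submodule.mem_iInf] at hv
  by_contra hvN
  have hcolon : N.colon {v} ≠ ⊤ := by
    rwa [Ideal.ne_top_iff_one, Submodule.mem_colon_singleton, one_smul]
  obtain ⟨P, hP, hle⟩ := Ideal.exists_le_maximal _ hcolon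
  obtain ⟨s, hs, hsv⟩ := hv ⟨P, hP.isPrime⟩
  exact hs (hle (Submodule.mem_colon_singleton.mpr hsv))

theorem saturation_smul_saturation (J : Ideal A) (N : Submodule A V) :
    saturation S (saturation S J • saturation S N) = saturation S (J • N) := by
  refine le_antisymm (saturation_le_saturation_iff.mpr (Submodule.smul_le.mpr ?_))
    (saturation_mono (Submodule.smul_mono le_saturation le_saturation))
  rintro a ⟨s, hs, ha⟩ v ⟨t, ht, hv⟩
  refine ⟨s * t, S.mul_mem hs ht, ?_⟩
  rw [smul_smul, mul_right_comm, mul_smul, ← smul_eq_mul s a]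
  exact Submodule.smul_mem_smul ha hv

end Saturation

section Ideal

variable {A : Type*} [CommRing A] {J : Ideal A}

theorem saturation_primeCompl_eq_top {P : PrimeSpectrum A} (h : ¬ J ≤ P.asIdeal) :
    saturation P.asIdeal.primeCompl J = ⊤ := by
  obtain ⟨s, hsJ, hsP⟩ := SetLike.not_le_iff_exists.mp h
  exact (Ideal.eq_top_iff_one _).mpr ⟨s, hsP, J.mul_mem_right 1 hsJ⟩

theorem saturation_eq_iInf_of_isRadical (hJ : J.IsRadical) (P : PrimeSpectrum A) :
    saturation P.asIdeal.primeCompl J =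
      ⨅ (p : PrimeSpectrum A) (_ : J ≤ p.asIdeal ∧ p.asIdeal ≤ P.asIdeal), p.asIdeal := by
  refine le_antisymm (le_iInf₂ fun p hp a ⟨s, hs, hsa⟩ => ?_) fun a ha => ?_
  · exact (p.2.mem_or_mem (hp.1 hsa)).resolve_left fun h => hs (hp.2 h)
  by_contra hsat
  have hdisj : Disjoint (J : Set A) (P.asIdeal.primeCompl ⊔ Submonoid.powers a : Submonoid A) := by
    refine Set.disjoint_left.mpr fun x hxJ hx => hsat ?_
    obtain ⟨s, hs, _, ⟨n, rfl⟩, rfl⟩ := Submonoid.mem_sup.mp hx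
    refine ⟨s, hs, hJ ⟨n + 1, ?_⟩⟩
    have hpow : (s • a) ^ (n + 1) = s ^ n * a * (s * a ^ n) := by rw [smul_eq_mul]; ring
    exact hpow ▸ J.mul_mem_left _ hxJ
  obtain ⟨p, hp, hJp, hpS⟩ := Ideal.exists_le_prime_disjoint J _ hdisj
  rw [Set.disjoint_left] at hpS
  have hpP : p ≤ P.asIdeal := fun x hx => by
    by_contra hxP
    exact hpS hx (Submonoid.mem_sup_left hxP)
  simp only [Submodule.mem_iInf] at ha
  exact hpS (ha ⟨p, hp⟩ ⟨hJp, hpP⟩) (Submonoid.mem_sup_right (Submonoid.mem_powers a))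

theorem saturation_eq_sInf_minimalPrimes (hJ : J.IsRadical) (P : PrimeSpectrum A) :
    saturation P.asIdeal.primeCompl J = sInf {p ∈ J.minimalPrimes | p ≤ P.asIdeal} := by
  rw [saturation_eq_iInf_of_isRadical hJ]
  refine le_antisymm (le_sInf fun p ⟨hp, hpP⟩ => ?_) (le_iInf₂ fun p hp => ?_)
  · exact iInf₂_le_of_le ⟨p, hp.1.1⟩ ⟨hp.1.2, hpP⟩ le_rfl
  obtain ⟨q, hq, hqp⟩ := Ideal.exists_minimalPrimes_le hp.1
  exact sInf_le_of_le ⟨hq, hqp.trans hp.2⟩ hqp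

theorem finite_range_saturation_primeCompl [IsNoetherianRing A] (hJ : J.IsRadical) :
    (Set.range fun P : PrimeSpectrum A => saturation P.asIdeal.primeCompl J).Finite := by
  refine ((Ideal.finite_minimalPrimes_of_isNoetherianRing A J).finite_subsets.image sInf).subset ?_
  rintro _ ⟨P, rfl⟩
  exact ⟨_, Set.sep_subset _ _, (saturation_eq_sInf_minimalPrimes hJ P).symm⟩

theorem eq_of_le_of_height_le_one {p q : Ideal A} [p.IsPrime] [q.IsPrime]
    (hp : ((p : Set A) ∩ nonZeroDivisors A).Nonempty) (hpq : p ≤ q) (hq : q.height ≤ 1) :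
    p = q := by
  by_contra hne
  have hheight : p.height + 1 ≤ 1 :=
    (Ideal.height_add_one_le_of_lt_of_isPrime (lt_of_le_of_ne hpq hne)).trans hq
  have hmin : p ∈ minimalPrimes A := Ideal.height_eq_zero_iff.mp
    (Order.lt_one_iff.mp ((ENat.add_one_le_iff' ENat.one_ne_top).mp hheight))
  exact Set.not_disjoint_iff_nonempty_inter.mpr hp
    (Ideal.disjoint_nonZeroDivisors_of_mem_minimalPrimes hmin)

theorem saturation_eq_self_of_height_le_one (hJ : J.IsRadical)
    (hreg : ((J : Set A) ∩ nonZeroDivisors A).Nonempty) {Q : PrimeSpectrum A}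
    (hJQ : J ≤ Q.asIdeal) (hQ : Q.asIdeal.height ≤ 1) :
    saturation Q.asIdeal.primeCompl J = Q.asIdeal := by
  rw [saturation_eq_iInf_of_isRadical hJ]
  refine le_antisymm (iInf₂_le_of_le Q ⟨hJQ, le_rfl⟩ le_rfl) (le_iInf₂ fun p hp => ?_)
  have hregp := hreg.mono (Set.inter_subset_inter_left _ (SetLike.coe_subset_coe.mpr hp.1))
  exact (eq_of_le_of_height_le_one hregp hp.2 hQ).ge

theorem saturation_eq_or_eq_top_of_height_le_one (hJ : J.IsRadical)
    (hreg : ((J : Set A) ∩ nonZeroDivisors A).Nonempty) {L : Ideal A} (hJL : J ≤ L)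
    {Q : PrimeSpectrum A} (hQ : Q.asIdeal.height ≤ 1) :
    saturation Q.asIdeal.primeCompl L = saturation Q.asIdeal.primeCompl J ∨
      saturation Q.asIdeal.primeCompl L = ⊤ := by
  refine (em (L ≤ Q.asIdeal)).imp (fun hLQ => ?_) saturation_primeCompl_eq_top
  refine le_antisymm (saturation_le_saturation_iff.mpr ?_) (saturation_mono hJL)
  exact hLQ.trans (saturation_eq_self_of_height_le_one hJ hreg (hJL.trans hLQ) hQ).ge

theorem nonempty_inter_nonZeroDivisors [IsReduced A] [IsNoetherianRing A]
    (h : ∀ p ∈ minimalPrimes A, ¬ J ≤ p) : ((J : Set A) ∩ nonZeroDivisors A).Nonempty := by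
  rw [← Set.not_disjoint_iff_nonempty_inter]
  intro hdisj
  obtain ⟨x, hx, hx0⟩ := Submodule.exists_mem_ne_zero_of_ne_bot
    (Ideal.bot_lt_annihilator_of_disjoint_nonZeroDivisors hdisj).ne'
  have hrad : (⊥ : Ideal A).radical = ⊥ := nilradical_eq_zero A
  have hsInf : x ∉ sInf (minimalPrimes A) := by
    rwa [minimalPrimes, Ideal.sInf_minimalPrimes, hrad]
  obtain ⟨p, hp, hxp⟩ : ∃ p ∈ minimalPrimes A, x ∉ p := by
    simpa only [Submodule.mem_sInf, not_forall, exists_prop] using hsInf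
  refine h p hp fun a ha => (hp.1.1.mem_or_mem (?_ : x * a ∈ p)).resolve_left hxp
  have hxa : x * a = 0 := congrArg Subtype.val (Module.mem_annihilator.mp hx ⟨a, ha⟩)
  exact hxa ▸ p.zero_mem

end Ideal

section Algebra

variable {A : Type*} [CommRing A] {K : Type*} [CommRing K] [Algebra A K] {S : Submonoid A}

theorem fg_div [IsNoetherianRing A] {M N : Submodule A K} (hM : M.FG)
    (hN : ((N : Set K) ∩ nonZeroDivisors K).Nonempty) : (M / N).FG := by
  obtain ⟨y, hyN, hy⟩ := hN
  have hinj : Function.Injective (LinearMap.mulRight A y) := fun _ _ h =>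
    (mul_cancel_right_mem_nonZeroDivisors hy).mp h
  refine Submodule.fg_of_fg_map_injective _ hinj (hM.of_le ?_)
  rintro _ ⟨x, hx, rfl⟩
  exact Submodule.mem_div_iff_forall_mul_mem.mp hx y hyN

theorem saturation_div {M N : Submodule A K} (hN : N.FG) :
    saturation S (M / N) = saturation S M / saturation S N := by
  apply le_antisymm
  · rintro x ⟨s, hs, hx⟩
    refine Submodule.mem_div_iff_forall_mul_mem.mpr fun y ⟨t, ht, hy⟩ => ?_
    refine ⟨s * t, S.mul_mem hs ht, ?_⟩
    rw [← smul_mul_smul_comm]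
    exact Submodule.mem_div_iff_forall_mul_mem.mp hx _ hy
  · intro x hx
    have hle : N.map (LinearMap.mulLeft A x) ≤ saturation S M := by
      rintro _ ⟨y, hy, rfl⟩
      exact Submodule.mem_div_iff_forall_mul_mem.mp hx y (le_saturation hy)
    obtain ⟨s, hs, hsx⟩ := exists_smul_mem_of_fg_of_le_saturation (hN.map _) hle
    refine ⟨s, hs, Submodule.mem_div_iff_forall_mul_mem.mpr fun y hy => ?_⟩
    rw [smul_mul_assoc]
    exact hsx _ ⟨y, hy, rfl⟩

theorem pow_mem_saturation {B : Subalgebra A K} {x : K} (hx : x ∈ saturation S B.toSubmodule)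
    (n : ℕ) : x ^ n ∈ saturation S B.toSubmodule := by
  obtain ⟨s, hs, hsx⟩ := hx
  exact ⟨s ^ n, pow_mem hs n, by rw [← smul_pow]; exact B.pow_mem hsx n⟩

theorem mul_mem_smul_toSubmodule {B : Subalgebra A K} {J : Ideal A} {x y : K} (hx : x ∈ B)
    (hy : y ∈ J • B.toSubmodule) : x * y ∈ J • B.toSubmodule := by
  rw [← B.isIdempotentElem_toSubmodule.eq, ← mul_smul_comm]
  exact Submodule.mul_mem_mul hx hy

/-- The ideal `√(JB)` of the `A`-subalgebra `B`, as an `A`-submodule of the ambient algebra `K`,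
where such ideals for different `B` can be compared. -/
def radicalExt (B : Subalgebra A K) (J : Ideal A) : Submodule A K :=
  ((J.map (algebraMap A B)).radical.restrictScalars A).map B.val.toLinearMap

variable {B B' : Subalgebra A K} {J J' : Ideal A}

theorem coe_mem_smul_toSubmodule_iff {b : B} :
    (b : K) ∈ J • B.toSubmodule ↔ b ∈ J.map (algebraMap A B) := by
  refine (Submodule.mem_smul_top_iff J B.toSubmodule b).symm.trans ?_
  rw [← Submodule.restrictScalars_mem A (J.map _), ← Ideal.smul_top_eq_map]

theorem mem_radicalExt {y : K} :
    y ∈ radicalExt B J ↔ y ∈ B ∧ ∃ n : ℕ, y ^ n ∈ J • B.toSubmodule := by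
  constructor
  · rintro ⟨b, ⟨n, hn⟩, rfl⟩
    exact ⟨b.2, n, coe_mem_smul_toSubmodule_iff.mpr hn⟩
  · rintro ⟨hy, n, hn⟩
    exact ⟨⟨y, hy⟩, ⟨n, coe_mem_smul_toSubmodule_iff.mp hn⟩, rfl⟩

theorem radicalExt_le : radicalExt B J ≤ B.toSubmodule := fun _ hy => (mem_radicalExt.mp hy).1

theorem algebraMap_mem_radicalExt {a : A} (ha : a ∈ J) : algebraMap A K a ∈ radicalExt B J :=
  ⟨algebraMap A B a, Ideal.le_radical (Ideal.mem_map_of_mem _ ha), rfl⟩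

theorem radicalExt_top : radicalExt B ⊤ = B.toSubmodule :=
  le_antisymm radicalExt_le fun y hy =>
    mem_radicalExt.mpr ⟨hy, 1, by rwa [Submodule.top_smul, pow_one]⟩

theorem mem_saturation_radicalExt {y : K} :
    y ∈ saturation S (radicalExt B J) ↔
      y ∈ saturation S B.toSubmodule ∧ ∃ n : ℕ, y ^ n ∈ saturation S (J • B.toSubmodule) := by
  constructor
  · rintro ⟨s, hs, hsy⟩
    obtain ⟨hB, n, hn⟩ := mem_radicalExt.mp hsy
    exact ⟨⟨s, hs, hB⟩, n, s ^ n, pow_mem hs n, by rwa [← smul_pow]⟩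
  · rintro ⟨⟨s, hs, hsy⟩, n, t, ht, hty⟩
    refine ⟨t * s, S.mul_mem ht hs, mem_radicalExt.mpr ⟨?_, n + 1, ?_⟩⟩
    · rw [mul_smul]
      exact B.smul_mem hsy t
    · have hpow : ((t * s) • y) ^ (n + 1) = ((t * s) ^ n • s • y) * (t • y ^ n) := by
        simp only [Algebra.smul_def, map_mul, map_pow]
        ring
      exact hpow ▸ mul_mem_smul_toSubmodule (B.smul_mem hsy _) hty

theorem saturation_radicalExt_congr
    (hB : saturation S B.toSubmodule = saturation S B'.toSubmodule)
    (hJ : saturation S J = saturation S J') :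
    saturation S (radicalExt B J) = saturation S (radicalExt B' J') := by
  ext y
  rw [mem_saturation_radicalExt, mem_saturation_radicalExt, ← saturation_smul_saturation,
    ← saturation_smul_saturation (J := J'), hB, hJ]

end Algebra

section Chain

variable {A : Type*} [CommRing A]

theorem endRing_toSubmodule (B : Subalgebra A (FractionRing A)) (I : Ideal B) :
    (endRing B I).toSubmodule = (I.restrictScalars A).map B.val.toLinearMap /
      (I.restrictScalars A).map B.val.toLinearMap := by
  ext x
  rw [Submodule.mem_div_iff_forall_mul_mem]
  constructor
  · rintro ⟨φ, hφ⟩ _ ⟨b, hb, rfl⟩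
    exact ⟨_, (φ ⟨b, hb⟩).2, hφ ⟨b, hb⟩⟩
  · intro h
    have hmul : ∀ j : I, ∃ k : I, ((k : B) : FractionRing A) = x * ((j : B) : FractionRing A) := by
      intro j
      obtain ⟨k, hk, hkx⟩ := h _ ⟨j.1, j.2, rfl⟩
      exact ⟨⟨k, hk⟩, hkx⟩
    choose φ hφ using hmul
    refine ⟨⟨⟨φ, fun a b => ?_⟩, fun c a => ?_⟩, hφ⟩ <;> apply Subtype.ext <;> apply Subtype.ext
    · simp [hφ, mul_add]
    · simp [hφ, mul_left_comm]

theorem chain_succ_toSubmodule (J : Ideal A) (i : ℕ) :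
    (chain J (i + 1)).toSubmodule = radicalExt (chain J i) J / radicalExt (chain J i) J :=
  endRing_toSubmodule _ _

theorem mem_chain_succ {J : Ideal A} {i : ℕ} {x : FractionRing A} :
    x ∈ chain J (i + 1) ↔
      ∀ y ∈ radicalExt (chain J i) J, x * y ∈ radicalExt (chain J i) J := by
  rw [← Subalgebra.mem_toSubmodule, chain_succ_toSubmodule, Submodule.mem_div_iff_forall_mul_mem]

theorem chain_le_succ (J : Ideal A) (i : ℕ) : chain J i ≤ chain J (i + 1) := by
  intro x hx
  rw [mem_chain_succ]
  rintro _ ⟨b, hb, rfl⟩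
  exact ⟨⟨x, hx⟩ * b, Ideal.mul_mem_left _ _ hb, rfl⟩

theorem chain_top_succ (i : ℕ) : chain (⊤ : Ideal A) i = chain ⊤ (i + 1) := by
  refine le_antisymm (chain_le_succ ⊤ i) fun x hx => ?_
  have hmul := mem_chain_succ.mp hx 1
  rw [radicalExt_top, mul_one] at hmul
  exact hmul (chain ⊤ i).one_mem

theorem chain_eq_succ_of_le {J : Ideal A} {m n : ℕ} (hmn : m ≤ n)
    (h : chain J m = chain J (m + 1)) : chain J n = chain J (n + 1) := by
  induction n, hmn using Nat.le_induction with
  | base => exact h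
  | succ n _ ih => exact congrArg (fun B => endRing B (J.map (algebraMap A B)).radical) ih

theorem chain_fg [IsNoetherianRing A] {J : Ideal A}
    (hJ : ((J : Set A) ∩ nonZeroDivisors A).Nonempty) (i : ℕ) : (chain J i).toSubmodule.FG := by
  obtain ⟨g, hgJ, hg⟩ := hJ
  induction i with
  | zero =>
    change (⊥ : Subalgebra A (FractionRing A)).toSubmodule.FG
    rw [Algebra.toSubmodule_bot, Submodule.one_eq_span]
    exact Submodule.fg_span_singleton 1
  | succ i ih =>
    rw [chain_succ_toSubmodule]
    exact fg_div (ih.of_le radicalExt_le) ⟨_, algebraMap_mem_radicalExt hgJ,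
      IsLocalization.map_nonZeroDivisors_le (nonZeroDivisors A) _ ⟨g, hg, rfl⟩⟩

theorem saturation_chain_congr [IsNoetherianRing A] {S : Submonoid A} {J J' : Ideal A}
    (hJ : ((J : Set A) ∩ nonZeroDivisors A).Nonempty)
    (hJ' : ((J' : Set A) ∩ nonZeroDivisors A).Nonempty)
    (h : saturation S J = saturation S J') (i : ℕ) :
    saturation S (chain J i).toSubmodule = saturation S (chain J' i).toSubmodule := by
  induction i with
  | zero => rfl
  | succ i ih =>
    rw [chain_succ_toSubmodule, chain_succ_toSubmodule,
      saturation_div ((chain_fg hJ i).of_le radicalExt_le),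
      saturation_div ((chain_fg hJ' i).of_le radicalExt_le), saturation_radicalExt_congr ih h]

theorem chain_succ_le_saturation [IsNoetherianRing A] {S : Submonoid A} {J J' : Ideal A}
    (hJ : ((J : Set A) ∩ nonZeroDivisors A).Nonempty)
    (hJ' : ((J' : Set A) ∩ nonZeroDivisors A).Nonempty)
    (h : saturation S J = saturation S J') {n : ℕ} (hn : chain J' n = chain J' (n + 1)) :
    (chain J (n + 1)).toSubmodule ≤ saturation S (chain J n).toSubmodule :=
  calc (chain J (n + 1)).toSubmodule
    _ ≤ saturation S (chain J (n + 1)).toSubmodule := le_saturation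
    _ = saturation S (chain J' (n + 1)).toSubmodule := saturation_chain_congr hJ hJ' h (n + 1)
    _ = saturation S (chain J' n).toSubmodule := by rw [hn]
    _ = saturation S (chain J n).toSubmodule := (saturation_chain_congr hJ hJ' h n).symm

end Chain

section NumSteps

variable {A : Type u} [CommRing A] {J : Ideal A}

theorem numSteps_le_iff {n : ℕ} : numSteps A J ≤ n ↔ chain J n = chain J (n + 1) := by
  refine ⟨fun h => ?_, fun h => iInf₂_le n h⟩
  have hlt : numSteps A J < (n + 1 : ℕ) := h.trans_lt (by exact_mod_cast n.lt_succ_self)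
  simp only [numSteps, iInf_lt_iff] at hlt
  obtain ⟨m, hm, hmn⟩ := hlt
  exact chain_eq_succ_of_le (Nat.lt_succ_iff.mp (by exact_mod_cast hmn)) hm

theorem numSteps_top : numSteps A ⊤ = 0 :=
  le_antisymm (numSteps_le_iff.mpr (chain_top_succ 0)) bot_le

theorem numSteps_le_iSup_saturation [IsNoetherianRing A]
    (hJ : ((J : Set A) ∩ nonZeroDivisors A).Nonempty) :
    numSteps A J ≤ ⨆ P : PrimeSpectrum A, numSteps A (saturation P.asIdeal.primeCompl J) := by
  refine WithTop.forall_le_coe_iff_le.mp fun n hn => numSteps_le_iff.mpr ?_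
  refine le_antisymm (chain_le_succ J n) (Subalgebra.toSubmodule.le_iff_le.mp ?_)
  rw [← iInf_saturation_primeCompl (chain J n).toSubmodule]
  refine le_iInf fun P => ?_
  exact chain_succ_le_saturation hJ (hJ.mono fun x hx => ⟨le_saturation hx.1, hx.2⟩)
    saturation_saturation.symm (numSteps_le_iff.mp ((le_iSup _ P).trans hn))

end NumSteps

section CodimOne

variable {A : Type*} [CommRing A]

/-- The elements that lie in `N` locally at every prime of height at most one. It controls the
chain of rings under Serre's condition `(S₂)`. -/
def codimOneClosure {V : Type*} [AddCommGroup V] [Module A V] (N : Submodule A V) :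
    Submodule A V :=
  ⨅ (Q : PrimeSpectrum A) (_ : Q.asIdeal.height ≤ 1), saturation Q.asIdeal.primeCompl N

theorem mem_codimOneClosure {V : Type*} [AddCommGroup V] [Module A V] {N : Submodule A V} {v : V} :
    v ∈ codimOneClosure N ↔ ∀ Q : PrimeSpectrum A, Q.asIdeal.height ≤ 1 →
      v ∈ saturation Q.asIdeal.primeCompl N := by
  simp only [codimOneClosure, Submodule.mem_iInf]

theorem codimOneClosure_chain_le
    (h : codimOneClosure (1 : Submodule A (FractionRing A)) ≤ 1) (J : Ideal A) (i : ℕ) :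
    codimOneClosure (chain J i).toSubmodule ≤ (chain J i).toSubmodule := by
  induction i with
  | zero => exact Algebra.toSubmodule_bot (R := A) (A := FractionRing A) ▸ h
  | succ i ih =>
    have hmul : ∀ x ∈ codimOneClosure (chain J (i + 1)).toSubmodule,
        ∀ y ∈ radicalExt (chain J i) J, x * y ∈ chain J i := by
      intro x hx y hy
      refine ih (mem_codimOneClosure.mpr fun Q hQ => ?_)
      obtain ⟨s, hs, hsx⟩ := mem_codimOneClosure.mp hx Q hQ
      refine ⟨s, hs, ?_⟩
      rw [← smul_mul_assoc]
      exact radicalExt_le (mem_chain_succ.mp hsx y hy)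
    refine fun x hx => mem_chain_succ.mpr fun y hy => ?_
    obtain ⟨-, n, hn⟩ := mem_radicalExt.mp hy
    refine mem_radicalExt.mpr ⟨hmul x hx y hy, n + 1, ?_⟩
    have hxpow : x ^ (n + 1) ∈ codimOneClosure (chain J (i + 1)).toSubmodule :=
      mem_codimOneClosure.mpr fun Q hQ => pow_mem_saturation (mem_codimOneClosure.mp hx Q hQ) _
    have hpow : (x * y) ^ (n + 1) = x ^ (n + 1) * y * y ^ n := by ring
    exact hpow ▸ mul_mem_smul_toSubmodule (hmul _ hxpow y hy) hn

open scoped Pointwise in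
theorem dvd_of_two_le_depth {R : Type*} [CommRing R] [IsLocalRing R] (h : 2 ≤ depth R)
    {b c : R} (hb : b ∈ nonZeroDivisors R) (hc : ∀ r ∈ IsLocalRing.maximalIdeal R, b ∣ r * c) :
    b ∣ c := by
  have hlt : (1 : ℕ∞) < depth R := lt_of_lt_of_le (by norm_num) h
  simp only [depth, lt_iSup_iff] at hlt
  obtain ⟨rs, ⟨hrs, hreg⟩, hlen⟩ := hlt
  match rs, hrs, hreg, hlen with
  | [], _, _, hlen => simp at hlen
  | [_], _, _, hlen => simp at hlen
  | r₁ :: r₂ :: rs, hrs, hreg, _ =>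
    rw [RingTheory.Sequence.isRegular_cons_iff, RingTheory.Sequence.isRegular_cons_iff] at hreg
    obtain ⟨hr₁, hr₂, -⟩ := hreg
    obtain ⟨p, hp⟩ := hc r₁ (hrs _ (by simp))
    obtain ⟨q, hq⟩ := hc r₂ (hrs _ (by simp))
    have hpq : r₂ * p = r₁ * q :=
      (mul_cancel_left_mem_nonZeroDivisors hb).mp (by linear_combination r₁ * hq - r₂ * hp)
    have hmem : p ∈ (r₁ • ⊤ : Submodule R R) := by
      rw [← Submodule.Quotient.mk_eq_zero]
      apply hr₂
      simp only [smul_zero]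
      rw [← Submodule.Quotient.mk_smul, Submodule.Quotient.mk_eq_zero, smul_eq_mul, hpq]
      exact Submodule.smul_mem_pointwise_smul q r₁ ⊤ trivial
    obtain ⟨w, -, rfl⟩ := hmem
    exact ⟨w, hr₁ (by simpa [mul_left_comm] using hp)⟩

theorem algebraMap_dvd_algebraMap_iff (S : Submonoid A) {R : Type*} [CommRing R] [Algebra A R]
    [IsLocalization S R] {b c : A} :
    algebraMap A R b ∣ algebraMap A R c ↔ ∃ s ∈ S, b ∣ s * c := by
  simp only [← Ideal.mem_span_singleton, ← IsLocalization.algebraMap_mem_map_algebraMap_iff S R,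
    Ideal.map_span, Set.image_singleton]

theorem mem_colon_mk_iff_dvd {b c r : A} :
    r ∈ (⊥ : Submodule A (A ⧸ Ideal.span {b})).colon {Ideal.Quotient.mk _ c} ↔ b ∣ r * c := by
  rw [Submodule.mem_colon_singleton, Submodule.mem_bot, ← Ideal.mem_span_singleton,
    ← Ideal.Quotient.eq_zero_iff_mem]
  rfl

theorem height_le_one_of_isAssociatedPrime [IsNoetherianRing A] (hS : SerreS 2 A) {b : A}
    (hb : b ∈ nonZeroDivisors A) {P : Ideal A}
    (hP : IsAssociatedPrime P (A ⧸ Ideal.span {b})) : P.height ≤ 1 := by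
  obtain ⟨hPprime, c, hc⟩ := isAssociatedPrime_iff.mp hP
  obtain ⟨c, rfl⟩ := Ideal.Quotient.mk_surjective c
  by_contra! hheight
  have hdepth : 2 ≤ depth (Localization.AtPrime P) := by
    have hmin := hS ⟨P, hPprime⟩
    rw [IsLocalization.AtPrime.ringKrullDim_eq_height P, min_eq_left] at hmin
    · exact_mod_cast hmin
    · exact_mod_cast Order.add_one_le_of_lt hheight
  have hdvd : algebraMap A (Localization.AtPrime P) b ∣ algebraMap A _ c := by
    refine dvd_of_two_le_depth hdepth
      (IsLocalization.map_nonZeroDivisors_le P.primeCompl _ ⟨b, hb, rfl⟩) fun r hr => ?_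
    obtain ⟨r, s, rfl⟩ := IsLocalization.exists_mk'_eq P.primeCompl r
    rw [IsLocalization.AtPrime.mk'_mem_maximal_iff _ P, hc, mem_colon_mk_iff_dvd] at hr
    rw [mul_comm, IsLocalization.mul_mk'_eq_mk'_of_mul, mul_comm c,
      IsLocalization.mk'_eq_mul_mk'_one]
    exact (map_dvd _ hr).mul_right _
  obtain ⟨s, hs, hsc⟩ := (algebraMap_dvd_algebraMap_iff P.primeCompl).mp hdvd
  exact hs (hc ▸ mem_colon_mk_iff_dvd.mpr hsc)

theorem smul_mk'_mem_one_iff {K : Type*} [CommRing K] [Algebra A K] [IsFractionRing A K]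
    {s a : A} {b : nonZeroDivisors A} :
    s • IsLocalization.mk' K a b ∈ (1 : Submodule A K) ↔ (b : A) ∣ s * a := by
  rw [Submodule.mem_one, Algebra.smul_def, IsLocalization.mul_mk'_eq_mk'_of_mul]
  simp only [IsLocalization.eq_mk'_iff_mul_eq, ← map_mul, (IsFractionRing.injective A K).eq_iff]
  exact exists_congr fun z => by rw [mul_comm, eq_comm]

theorem codimOneClosure_one_le [IsNoetherianRing A] (hS : SerreS 2 A) {K : Type*} [CommRing K]
    [Algebra A K] [IsFractionRing A K] : codimOneClosure (1 : Submodule A K) ≤ 1 := by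
  intro x hx
  obtain ⟨a, b, rfl⟩ := IsLocalization.exists_mk'_eq (nonZeroDivisors A) x
  by_contra hmem
  have ha : Ideal.Quotient.mk (Ideal.span {(b : A)}) a ≠ 0 := by
    rwa [Ne, Ideal.Quotient.eq_zero_iff_mem, Ideal.mem_span_singleton, ← one_mul a,
      ← smul_mk'_mem_one_iff (K := K), one_smul]
  obtain ⟨P, hP, hle⟩ := exists_le_isAssociatedPrime_of_isNoetherianRing A _ ha
  obtain ⟨s, hs, hsx⟩ := mem_codimOneClosure.mp hx ⟨P, hP.isPrime⟩
    (height_le_one_of_isAssociatedPrime hS b.2 hP)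
  exact hs (hle (mem_colon_mk_iff_dvd.mpr (smul_mk'_mem_one_iff.mp hsx)))

end CodimOne

theorem numSteps_le_numSteps_of_le {A : Type u} [CommRing A] [IsNoetherianRing A]
    (hS : SerreS 2 A) {J L : Ideal A} (hJ : J.IsRadical)
    (hreg : ((J : Set A) ∩ nonZeroDivisors A).Nonempty) (hJL : J ≤ L) :
    numSteps A L ≤ numSteps A J := by
  have hregL : ((L : Set A) ∩ nonZeroDivisors A).Nonempty :=
    hreg.mono fun x hx => ⟨hJL hx.1, hx.2⟩
  refine le_iInf₂ fun n hn => numSteps_le_iff.mpr (le_antisymm (chain_le_succ L n) ?_)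
  refine fun x hx => codimOneClosure_chain_le (codimOneClosure_one_le hS) L n
    (mem_codimOneClosure.mpr fun Q hQ => ?_)
  rcases saturation_eq_or_eq_top_of_height_le_one hJ hreg hJL hQ with hLJ | htop
  · exact chain_succ_le_saturation hregL hreg hLJ hn hx
  · have hsat : saturation Q.asIdeal.primeCompl L = saturation Q.asIdeal.primeCompl ⊤ :=
      htop.trans (top_le_iff.mp le_saturation).symm
    exact chain_succ_le_saturation (J' := ⊤) hregL ⟨1, trivial, one_mem _⟩ hsat
      (chain_top_succ n) hx

section SingularLocus

variable {A : Type u} [CommRing A]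

theorem notMem_sing_of_mem_minimalPrimes [IsReduced A] {P : PrimeSpectrum A}
    (hP : P.asIdeal ∈ minimalPrimes A) : P ∉ Sing A := by
  have : Ring.KrullDimLE 0 (Localization.AtPrime P.asIdeal) := .of_isLocalization _ hP _
  let : Field (Localization.AtPrime P.asIdeal) := Ring.KrullDimLE.isField_of_isReduced.toField
  exact not_not.mpr (inferInstance : IsRegularLocalRing (Localization.AtPrime P.asIdeal))

theorem vanishingIdeal_le_asIdeal_iff {Z : Set (PrimeSpectrum A)} (hZ : IsClosed Z)
    {P : PrimeSpectrum A} : PrimeSpectrum.vanishingIdeal Z ≤ P.asIdeal ↔ P ∈ Z := by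
  rw [← SetLike.coe_subset_coe, ← PrimeSpectrum.mem_zeroLocus,
    PrimeSpectrum.zeroLocus_vanishingIdeal_eq_closure, hZ.closure_eq]

theorem nonempty_vanishingIdeal_sing_inter_nonZeroDivisors [IsReduced A] [IsNoetherianRing A]
    (hcl : IsClosed (Sing A)) :
    ((PrimeSpectrum.vanishingIdeal (Sing A) : Set A) ∩ nonZeroDivisors A).Nonempty :=
  nonempty_inter_nonZeroDivisors fun p hp hle =>
    notMem_sing_of_mem_minimalPrimes (P := ⟨p, hp.1.1⟩) hp
      ((vanishingIdeal_le_asIdeal_iff hcl).mp hle)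

theorem idealAt_eq_saturation (hcl : IsClosed (Sing A)) (P : PrimeSpectrum A) :
    idealAt A P = saturation P.asIdeal.primeCompl (PrimeSpectrum.vanishingIdeal (Sing A)) := by
  simp only [saturation_eq_iInf_of_isRadical (PrimeSpectrum.isRadical_vanishingIdeal _),
    vanishingIdeal_le_asIdeal_iff hcl, idealAt]

theorem finite_strata [IsNoetherianRing A] (hcl : IsClosed (Sing A)) : (Strata A).Finite := by
  refine .image _ (.subset (finite_range_saturation_primeCompl
    (PrimeSpectrum.isRadical_vanishingIdeal (Sing A))) ?_)
  rintro _ ⟨P, -, rfl⟩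
  exact ⟨P, (idealAt_eq_saturation hcl P).symm⟩

theorem iSup_strata_stratumIdeal {α : Type*} [CompleteLattice α] (f : Ideal A → α) :
    ⨆ W ∈ Strata A, f (stratumIdeal A W) = ⨆ P ∈ Sing A, f (idealAt A P) := by
  simp only [Strata, iSup_image]
  refine iSup_congr fun P => iSup_congr fun hP => ?_
  rw [stratumIdeal_eq A (Set.mem_image_of_mem _ (Set.mem_image_of_mem _ hP)) ⟨hP, rfl⟩]

theorem iSup_sing_numSteps_idealAt (hcl : IsClosed (Sing A)) :
    ⨆ P ∈ Sing A, numSteps A (idealAt A P) = ⨆ P : PrimeSpectrum A, numSteps A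
      (saturation P.asIdeal.primeCompl (PrimeSpectrum.vanishingIdeal (Sing A))) := by
  refine iSup_congr fun P => ?_
  rw [← idealAt_eq_saturation hcl]
  by_cases hP : P ∈ Sing A
  · rw [iSup_pos hP]
  · rw [iSup_neg hP, idealAt_eq_saturation hcl, saturation_primeCompl_eq_top
      (mt (vanishingIdeal_le_asIdeal_iff hcl).mp hP), numSteps_top, bot_eq_zero]

end SingularLocus

theorem mainTheorem2_general (A : Type u) [CommRing A] [IsReduced A] [IsNoetherianRing A]
    (hcl : IsClosed (Sing A)) :
    (Strata A).Finite ∧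
    numSteps A (PrimeSpectrum.vanishingIdeal (Sing A)) ≤
      (⨆ W ∈ Strata A, numSteps A (stratumIdeal A W)) ∧
    (SerreS 2 A → numSteps A (PrimeSpectrum.vanishingIdeal (Sing A)) =
      ⨆ W ∈ Strata A, numSteps A (stratumIdeal A W)) := by
  have hreg := nonempty_vanishingIdeal_sing_inter_nonZeroDivisors hcl
  have hle := numSteps_le_iSup_saturation hreg
  rw [iSup_strata_stratumIdeal (numSteps A), iSup_sing_numSteps_idealAt hcl]
  refine ⟨finite_strata hcl, hle, fun hS => le_antisymm hle (iSup_le fun P => ?_)⟩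
  exact numSteps_le_numSteps_of_le hS (PrimeSpectrum.isRadical_vanishingIdeal _) hreg le_saturation

end StratNorm

theorem mainTheorem2 (A : Type u) [CommRing A] [IsReduced A] (hA : StratNorm.IsExcellentRing A) :
    (StratNorm.Strata A).Finite ∧
    StratNorm.numSteps A (PrimeSpectrum.vanishingIdeal (StratNorm.Sing A)) ≤
      (⨆ W ∈ StratNorm.Strata A, StratNorm.numSteps A (StratNorm.stratumIdeal A W)) ∧
    (StratNorm.IsEquidimensional A → StratNorm.SerreS 2 A →
      StratNorm.numSteps A (PrimeSpectrum.vanishingIdeal (StratNorm.Sing A)) =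
        ⨆ W ∈ StratNorm.Strata A, StratNorm.numSteps A (StratNorm.stratumIdeal A W)) := by
  have := hA.isNoetherianRing
  have h := StratNorm.mainTheorem2_general A ⟨hA.isOpen_regularLocus A⟩
  exact ⟨h.1, h.2.1, fun _ => h.2.2⟩
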